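/- Let $T\ge 0$ and let $X=(X_t)_{t\in[0,T]}$ be a continuous centered Gaussian semimartingale starting from $0$ on a probability space $(\Omega,\mathcal A,\mathbb P)$, with natural filtration $\mathcal F^X_s=\sigma(X_u,\ u\le s)$. Let $I$ be a finite set, let $(f_i)_{i\in I}$ be bounded measurable functions on $[0,T]$, and put $\overline Z_T=(Z_T^i)_{i\in I}$ with $Z_T^i=\int_0^T f_i(u)\,dX_u$. For $s\in[0,T)$ let $$Q(s,T)=\mathbb E\Big[\big(\overline Z_T-\mathbb E[\overline Z_T\mid \mathcal F^X_s]\big)\big(\overline Z_T-\mathbb E[\overline Z_T\mid \mathcal F^X_s]\big)^{*}\ \Big|\ \mathcal F^X_s\Big]$$ be the conditional covariance matrix of $\overline Z_T$ given the path $(X_u)_{u\in[0,s]}$, and assume $(\mathcal H)$: for every $s\in[0,T)$, $Q(s,T)$ is almost surely invertible. Then, for every $s\in[0,T)$: 1. The conditional distribution of $\overline Z_T$ given $(X_u)_{u\in[0,s]}$ almost surely has a density $\Pi_{(X_u)_{u\in[0,s]},T}$ with respect to Lebesgue measure on $\mathbb R^I$, namely the density of the Gaussian distribution with mean $\mathbb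 E[\overline Z_T\mid\mathcal F^X_s]$ and covariance matrix $Q(s,T)$. The distribution $\mathbb P_{\overline Z_T}$ of $\overline Z_T$ has a density $\Pi_{0,T}$, namely the density of the centered Gaussian distribution with covariance matrix $\mathbb E[\overline Z_T\overline Z_T^{*}]$. 2. Let $\mathbb P[\,\cdot\mid\overline Z_T=\overline z\,]$, $\overline z\in\mathbb R^I$, be any regular conditional probability on $(\Omega,\mathcal A)$ given $\overline Z_T$. For any versions of the densities $\Pi_{(X_u)_{u\in[0,s]},T}(\overline z)$ (jointly measurable in the path up to $s$ and $\overline z$) and $\Pi_{0,T}(\overline z)$ (measurable in $\overline z$), and for $\mathbb P_{\overline Z_T}$-almost every $\overline z\in\mathbb R^I$, the probability $\mathbb P[\,\cdot\mid\overline Z_T=\overline z\,]$ is equivalent to $\mathbb P$ on $\mathcal F^X_s$ (each is absolutely continuous with respect to the other there), with Radon–Nikodym density $$\frac{d\mathbb P[\,\cdot\mid\overline Z_T=\overline z\,]}{d\mathbb P}\bigg|_{\mathcal F^X_s}=\frac{\Pi_{(X_u)_{u\in[0,s]},T}(\overline z)}{\Pi_{0,T}(\overline z)}.$$ -/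

import Mathlib

open MeasureTheory ProbabilityTheory Filter Topology
open scoped NNReal ENNReal

noncomputable section

namespace GaussianBridge

/-! Processes on the time interval `[0, T]` are indexed by `Set.Iic T` with `T : ℝ≥0`. -/

/-- `X` is a continuous semimartingale on `[0, T]` for the filtration `𝓖`: almost surely, `X` is the
sum of a continuous `𝓖`-local martingale `M` and a continuous `𝓖`-adapted process `V` of finite
variation vanishing at time `0`. -/
def IsContinuousSemimartingale {Ω : Type*} [mΩ : MeasurableSpace Ω] {T : ℝ≥0}
    (X : Set.Iic T → Ω → ℝ) (𝓖 : Filtration (Set.Iic T) mΩ) (P : Measure Ω) : Prop :=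
  StronglyAdapted 𝓖 X ∧
  ∃ M V : Set.Iic T → Ω → ℝ,
    (StronglyAdapted 𝓖 M ∧ Locally (fun Y => Martingale Y 𝓖 P) 𝓖 M P ∧
      ∀ᵐ ω ∂P, Continuous fun t => M t ω) ∧
    (StronglyAdapted 𝓖 V ∧ ∀ᵐ ω ∂P, V ⊥ ω = 0 ∧ (Continuous fun t => V t ω) ∧
      BoundedVariationOn (fun t => V t ω) Set.univ) ∧
    ∀ᵐ ω ∂P, ∀ t, X t ω = M t ω + V t ω

/-- `HasIntegral X P f Z` says that `Z = ∫₀ᵀ f(s) dX_s` almost surely, for a deterministic bounded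
integrand `f`. The relation is the closure of `𝟙_(a,b] ↦ X_b - X_a` under linear combinations and
under bounded pointwise limits of integrands together with limits in probability of the integrals
(the value of the integrand at time `0` being irrelevant). When `X` is a continuous semimartingale,
the stochastic integral of bounded Borel functions obeys these rules, by the dominated convergence
theorem for stochastic integrals, and is determined by them, by the monotone class theorem: the
relation is its graph, with integrals identified up to almost sure equality. -/
inductive HasIntegral {Ω : Type*} [MeasurableSpace Ω] {T : ℝ≥0}
    (X : Set.Iic T → Ω → ℝ) (P : Measure Ω) : (Set.Iic T → ℝ) → (Ω → ℝ) → Prop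
  | step (a b : Set.Iic T) (hab : a ≤ b) :
      HasIntegral X P ((Set.Ioc a b).indicator fun _ => 1) (fun ω => X b ω - X a ω)
  | add {f g : Set.Iic T → ℝ} {Y Z : Ω → ℝ} :
      HasIntegral X P f Y → HasIntegral X P g Z →
        HasIntegral X P (fun t => f t + g t) (fun ω => Y ω + Z ω)
  | smul (c : ℝ) {f : Set.Iic T → ℝ} {Z : Ω → ℝ} :
      HasIntegral X P f Z → HasIntegral X P (fun t => c * f t) (fun ω => c * Z ω)
  | congr_pos {f g : Set.Iic T → ℝ} {Z : Ω → ℝ} :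
      (∀ t, ⊥ < t → f t = g t) → HasIntegral X P f Z → HasIntegral X P g Z
  | lim {f : ℕ → Set.Iic T → ℝ} {Z : ℕ → Ω → ℝ} {g : Set.Iic T → ℝ} {Y : Ω → ℝ} (C : ℝ) :
      (∀ n, HasIntegral X P (f n) (Z n)) → (∀ n t, |f n t| ≤ C) →
        (∀ t, Tendsto (fun n => f n t) atTop (𝓝 (g t))) → TendstoInMeasure P Z atTop Y →
        HasIntegral X P g Y

/-- The path `(X_u)_{u ∈ [0, s]}`, as a random element of `ℝ^[0, s]` with the cylinder σ-algebra. -/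
def path {Ω : Type*} {T : ℝ≥0} (X : Set.Iic T → Ω → ℝ) (s : Set.Iic T) (ω : Ω) : Set.Iic s → ℝ :=
  fun u => X u ω

/-- The conditional covariance matrix of `Z` given the σ-algebra `m`, as a random matrix: its
`(i, j)` entry is `E[(Z_i - E[Z_i | m]) (Z_j - E[Z_j | m]) | m]`. -/
def condCovMatrix {Ω : Type*} [MeasurableSpace Ω] {ι : Type*} (Z : ι → Ω → ℝ)
    (P : Measure Ω) (m : MeasurableSpace Ω) (ω : Ω) : Matrix ι ι ℝ :=
  Matrix.of fun i j =>
    (P[fun ω' => (Z i ω' - (P[Z i | m]) ω') * (Z j ω' - (P[Z j | m]) ω') | m]) ω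

/-- The density at `z` of the Gaussian distribution on `ℝ^ι` with mean `μ` and (invertible)
covariance matrix `Q`. -/
def gaussianDensity {ι : Type*} [Fintype ι] [DecidableEq ι] (μ : ι → ℝ) (Q : Matrix ι ι ℝ)
    (z : ι → ℝ) : ℝ≥0∞ :=
  ENNReal.ofReal ((√((2 * Real.pi) ^ Fintype.card ι * Q.det))⁻¹ *
    Real.exp (-(1 / 2) * ((z - μ) ⬝ᵥ (Q⁻¹.mulVec (z - μ)))))

/-- `D` is a jointly measurable density `D (X_u)_{u ∈ [0, s]} (z)`, with respect to Lebesgue measure,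
of the conditional distribution of `Z` given the path `(X_u)_{u ∈ [0, s]}`. It is written as a function
of `ω`; that it depends on `ω` only through the path is expressed by measurability with respect to
the σ-algebra generated by the path. -/
def IsCondDensity {Ω : Type*} [MeasurableSpace Ω] {T : ℝ≥0} {ι : Type*} [Fintype ι]
    (X : Set.Iic T → Ω → ℝ) (P : Measure Ω) [IsProbabilityMeasure P] (Z : Ω → ι → ℝ)
    (s : Set.Iic T) (D : Ω → (ι → ℝ) → ℝ≥0∞) : Prop :=
  @Measurable (Ω × (ι → ℝ)) ℝ≥0∞ ((MeasurableSpace.comap (path X s) inferInstance).prod inferInstance)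
    inferInstance (Function.uncurry D) ∧
  ∀ᵐ ω ∂P, condDistrib Z (path X s) P (path X s ω) = volume.withDensity (D ω)

/-- `D` is a density of the distribution of `Z` with respect to Lebesgue measure. -/
def IsLawDensity {Ω : Type*} [MeasurableSpace Ω] {ι : Type*} [Fintype ι]
    (P : Measure Ω) (Z : Ω → ι → ℝ) (D : (ι → ℝ) → ℝ≥0∞) : Prop :=
  Measurable D ∧ P.map Z = volume.withDensity D

/-- `κ` is a regular conditional probability `z ↦ P[ · | Z = z]`: a family of probability measures
on `Ω`, measurable in `z`, with `P[{Z ∈ B} ∩ A] = ∫_B κ_z(A) dP_Z(z)` for all measurable `A`, `B`. -/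
def IsRegularCondProb {Ω : Type*} [MeasurableSpace Ω] {E : Type*} [MeasurableSpace E]
    (P : Measure Ω) (Z : Ω → E) (κ : Kernel E Ω) : Prop :=
  IsMarkovKernel κ ∧ ∀ A B, MeasurableSet A → MeasurableSet B →
    P (Z ⁻¹' B ∩ A) = ∫⁻ z in B, κ z A ∂(P.map Z)

end GaussianBridge

end

/-! Everything takes place in the closed span `H` of the variables `X t` in `L²`. Its elements are
centered Gaussian, and it is stable under limits in probability
(`representsMem_of_tendstoInMeasure`), so every `Z i` lies in it.

Projecting `Z` onto the closed span of `X u`, `u ≤ s`, gives `Z = W(path) + R`. The residual `R` is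
orthogonal to the path, hence independent of it, because all these variables are jointly Gaussian
(`exists_regression`). The conditional law of `Z` is therefore the law of `R` translated by
`W(path)`, with a deterministic covariance matrix `Q`. Invertibility makes `Q` positive definite.
The covariance matrix of `Z` is `Q` plus a positive semidefinite matrix, so both laws have the
stated Gaussian densities.

The change of measure is Bayes' formula: computing the probability of `A ∩ {Z ∈ B}` by conditioning
on `Z` and on the path gives `D₀ z * κ z A = ∫_A D ω z dP` for almost every `z`, for each `A`
separately. Path continuity makes the σ-algebra of the path countably generated up to a null set, so
one exceptional set of `z` serves all `A`. Equivalence holds because Gaussian densities never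
vanish. -/

noncomputable section

namespace GaussianBridge

/-! ### Finite-dimensional Gaussian densities. -/

section GaussianDensity

variable {ι : Type*} [Fintype ι]

lemma pi_gaussianReal_eq_withDensity :
    Measure.pi (fun _ : ι => gaussianReal 0 1) =
      (volume : Measure (ι → ℝ)).withDensity
        fun x => ENNReal.ofReal (∏ i, gaussianPDFReal 0 1 (x i)) := by
  refine Measure.pi_eq fun s hs => ?_
  rw [withDensity_apply _ (MeasurableSet.univ_pi hs), ← lintegral_indicator (MeasurableSet.univ_pi hs)]
  have h1 : ∀ x : ι → ℝ, (Set.univ.pi s).indicator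
      (fun x => ENNReal.ofReal (∏ i, gaussianPDFReal 0 1 (x i))) x =
      ENNReal.ofReal (∏ i, (s i).indicator (gaussianPDFReal 0 1) (x i)) := by
    intro x
    by_cases hx : x ∈ Set.univ.pi s
    · rw [Set.indicator_of_mem hx]
      congr 1
      exact Finset.prod_congr rfl fun i _ => (Set.indicator_of_mem (hx i trivial) _).symm
    · rw [Set.indicator_of_notMem hx]
      simp only [Set.mem_pi, Set.mem_univ, true_imp_iff, not_forall] at hx
      obtain ⟨i, hi⟩ := hx
      rw [Finset.prod_eq_zero (Finset.mem_univ i) (Set.indicator_of_notMem hi _), ENNReal.ofReal_zero]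
  have hint : ∀ i, Integrable ((s i).indicator (gaussianPDFReal 0 1)) :=
    fun i => (integrable_gaussianPDFReal 0 1).indicator (hs i)
  have hnn : ∀ i y, 0 ≤ (s i).indicator (gaussianPDFReal 0 1) y :=
    fun i y => Set.indicator_nonneg (fun _ _ => gaussianPDFReal_nonneg 0 1 _) _
  simp_rw [h1]
  rw [← ofReal_integral_eq_lintegral_ofReal]
  · rw [integral_fintype_prod_volume_eq_prod (fun i => (s i).indicator (gaussianPDFReal 0 1)),
      ENNReal.ofReal_prod_of_nonneg fun i _ => integral_nonneg (hnn i)]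
    refine Finset.prod_congr rfl fun i _ => ?_
    rw [integral_indicator (hs i), gaussianReal_apply_eq_integral _ one_ne_zero]
  · exact Integrable.fintype_prod hint
  · exact Eventually.of_forall fun x => Finset.prod_nonneg fun i _ => hnn i _

variable [DecidableEq ι]

lemma measurable_gaussianDensity_right (μ : ι → ℝ) (Q : Matrix ι ι ℝ) :
    Measurable (gaussianDensity μ Q) := by
  unfold gaussianDensity
  fun_prop

/-- The quadratic form of `(A * Aᵀ)⁻¹` at `A y` is the squared Euclidean norm of `y`; the factor
`|det A|⁻¹` is the Jacobian that cancels in the change of variables `z = A y`. -/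
lemma gaussianDensity_zero_mul_transpose {A : Matrix ι ι ℝ} (hA : A.det ≠ 0) (y : ι → ℝ) :
    gaussianDensity 0 (A * A.transpose) (A.mulVec y) =
      ENNReal.ofReal |A.det|⁻¹ * ENNReal.ofReal (∏ i, gaussianPDFReal 0 1 (y i)) := by
  have hu : IsUnit A.det := hA.isUnit
  rw [gaussianDensity, ← ENNReal.ofReal_mul (by positivity)]
  congr 1
  have h1 : (A.mulVec y - 0) ⬝ᵥ ((A * A.transpose)⁻¹.mulVec (A.mulVec y - 0)) = ∑ i, y i ^ 2 := by
    rw [sub_zero, Matrix.mul_inv_rev, Matrix.mulVec_mulVec, Matrix.mul_assoc,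
      Matrix.nonsing_inv_mul _ hu, Matrix.mul_one, ← Matrix.transpose_nonsing_inv,
      Matrix.mulVec_transpose, dotProduct_comm, ← Matrix.dotProduct_mulVec,
      Matrix.mulVec_mulVec, Matrix.nonsing_inv_mul _ hu, Matrix.one_mulVec]
    simp [dotProduct, sq]
  have h2 : (√((2 * Real.pi) ^ Fintype.card ι * (A * A.transpose).det))⁻¹ =
      |A.det|⁻¹ * ∏ _i : ι, (√(2 * Real.pi))⁻¹ := by
    rw [Matrix.det_mul, Matrix.det_transpose, Real.sqrt_mul (by positivity), Real.sqrt_mul_self_eq_abs,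
      Finset.prod_const, Finset.card_univ, mul_inv, mul_comm, inv_pow]
    congr 2
    rw [show (2 * Real.pi) ^ Fintype.card ι = (√(2 * Real.pi) ^ Fintype.card ι) ^ 2 by
      rw [pow_right_comm, Real.sq_sqrt (by positivity)], Real.sqrt_sq (by positivity)]
  rw [h1, h2, mul_assoc]
  congr 1
  simp only [gaussianPDFReal, Finset.prod_mul_distrib, ← Real.exp_sum]
  congr 2
  · simp
  · rw [Finset.mul_sum]
    exact Finset.sum_congr rfl fun i _ => by simp; ring

lemma map_mulVec_pi_gaussianReal {A : Matrix ι ι ℝ} (hA : A.det ≠ 0) :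
    (Measure.pi (fun _ : ι => gaussianReal 0 1)).map A.mulVec =
      volume.withDensity (gaussianDensity 0 (A * A.transpose)) := by
  have hAm : Measurable (A.mulVec) := by fun_prop
  have hgm := measurable_gaussianDensity_right 0 (A * A.transpose)
  have hvol := Real.map_matrix_volume_pi_eq_smul_volume_pi hA
  ext s hs
  rw [Measure.map_apply hAm hs, pi_gaussianReal_eq_withDensity, withDensity_apply _ (hAm hs),
    withDensity_apply _ hs]
  have h1 : ∀ y : ι → ℝ, ENNReal.ofReal (∏ i, gaussianPDFReal 0 1 (y i)) =
      ENNReal.ofReal |A.det| * gaussianDensity 0 (A * A.transpose) (A.mulVec y) := by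
    intro y
    rw [gaussianDensity_zero_mul_transpose hA, ← mul_assoc, ← ENNReal.ofReal_mul (abs_nonneg _),
      mul_inv_cancel₀ (abs_ne_zero.2 hA), ENNReal.ofReal_one, one_mul]
  have h2 : ∫⁻ y in A.mulVec ⁻¹' s, gaussianDensity 0 (A * A.transpose) (A.mulVec y) =
      ∫⁻ z in s, gaussianDensity 0 (A * A.transpose) z ∂(Measure.map A.mulVec volume) := by
    rw [setLIntegral_map hs hgm hAm]
  simp_rw [h1]
  rw [lintegral_const_mul _ (by exact hgm.comp hAm), h2]
  change _ * ∫⁻ z in s, _ ∂(Measure.map (Matrix.toLin' A) volume) = _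
  rw [hvol, Measure.restrict_smul, lintegral_smul_measure, smul_eq_mul, ← mul_assoc,
    ← ENNReal.ofReal_mul (abs_nonneg _), abs_inv, mul_inv_cancel₀ (abs_ne_zero.2 hA),
    ENNReal.ofReal_one, one_mul]

/-- With `Q = A * Aᵀ`, the candidate is the image under `A` of the standard Gaussian measure. Its
characteristic function at `x` is the standard one at `Aᵀ x`, and the squared norm of `Aᵀ x` is `x
⬝ᵥ Q x`. -/
lemma eq_withDensity_gaussianDensity {Q : Matrix ι ι ℝ} (hQ : Q.PosDef) {μ : Measure (ι → ℝ)}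
    [IsFiniteMeasure μ]
    (hμ : ∀ x : ι → ℝ, ∫ v, Complex.exp ((x ⬝ᵥ v : ℝ) * Complex.I) ∂μ =
      Complex.exp (-((x ⬝ᵥ Q.mulVec x : ℝ) / 2 : ℂ))) :
    μ = volume.withDensity (gaussianDensity 0 Q) := by
  obtain ⟨A, rfl⟩ : ∃ A, Q = A * A.transpose := by
    open scoped MatrixOrder in
    obtain ⟨A, hA⟩ := CStarAlgebra.nonneg_iff_eq_mul_star_self.mp hQ.posSemidef.nonneg
    exact ⟨A, by simpa [Matrix.star_eq_conjTranspose] using hA⟩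
  have hA : A.det ≠ 0 := by
    have := hQ.det_pos
    rw [Matrix.det_mul] at this
    exact left_ne_zero_of_mul this.ne'
  have hAm : Measurable (A.mulVec) := by fun_prop
  rw [← map_mulVec_pi_gaussianReal hA]
  have := Measure.isProbabilityMeasure_map (μ := Measure.pi (fun _ : ι => gaussianReal 0 1))
    hAm.aemeasurable
  refine Measure.ext_of_charFunDual ?_
  ext L
  obtain ⟨x, hx⟩ : ∃ x : ι → ℝ, ∀ v, L v = x ⬝ᵥ v := by
    refine ⟨fun i => L (fun j => if i = j then 1 else 0), fun v => ?_⟩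
    refine (LinearMap.pi_apply_eq_sum_univ (L : (ι → ℝ) →ₗ[ℝ] ℝ) v).trans ?_
    simp [dotProduct, mul_comm]
  simp only [charFunDual_apply, hx]
  rw [hμ, integral_map hAm.aemeasurable (by fun_prop)]
  have h1 : ∀ y, Complex.exp ((x ⬝ᵥ A.mulVec y : ℝ) * Complex.I) =
      ∏ i, Complex.exp ((A.transpose.mulVec x i : ℝ) * (y i : ℝ) * Complex.I) := by
    intro y
    rw [← Complex.exp_sum, ← Finset.sum_mul, Matrix.dotProduct_mulVec, ← Matrix.mulVec_transpose]
    simp [dotProduct]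
  simp_rw [h1]
  rw [integral_fintype_prod_eq_prod (fun i (y : ℝ) =>
    Complex.exp ((A.transpose.mulVec x i : ℝ) * (y : ℝ) * Complex.I))]
  simp_rw [← charFun_apply_real, charFun_gaussianReal, ← Complex.exp_sum]
  congr 1
  rw [← Matrix.mulVec_mulVec, Matrix.dotProduct_mulVec, ← Matrix.mulVec_transpose]
  simp [dotProduct, Finset.sum_div, sq]

lemma gaussianDensity_sub (μ : ι → ℝ) (Q : Matrix ι ι ℝ) (z : ι → ℝ) :
    gaussianDensity μ Q z = gaussianDensity 0 Q (z - μ) := by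
  simp [gaussianDensity]

lemma gaussianDensity_pos {Q : Matrix ι ι ℝ} (hQ : Q.PosDef) (μ z : ι → ℝ) :
    0 < gaussianDensity μ Q z := by
  have := hQ.det_pos
  rw [gaussianDensity, ENNReal.ofReal_pos]
  positivity

lemma map_add_withDensity_gaussianDensity (μ : ι → ℝ) (Q : Matrix ι ι ℝ) :
    (volume.withDensity (gaussianDensity 0 Q)).map (fun z => μ + z) =
      volume.withDensity (gaussianDensity μ Q) := by
  ext s hs
  rw [Measure.map_apply (by fun_prop) hs, withDensity_apply _ (hs.preimage (by fun_prop)),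
    withDensity_apply _ hs]
  have := (measurePreserving_add_left (volume : Measure (ι → ℝ)) μ).setLIntegral_comp_preimage hs
    (measurable_gaussianDensity_right μ Q)
  rw [← this]
  simp [gaussianDensity_sub μ]

lemma measurable_gaussianDensity {β : Type*} {mβ : MeasurableSpace β} {m : β → ι → ℝ}
    {Q : β → Matrix ι ι ℝ} {z : β → ι → ℝ} (hm : ∀ i, Measurable fun b => m b i)
    (hQ : ∀ i j, Measurable fun b => Q b i j) (hz : ∀ i, Measurable fun b => z b i) :
    Measurable fun b => gaussianDensity (m b) (Q b) (z b) := by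
  have hQ' : Measurable (fun b i j => Q b i j) := by fun_prop
  have hdet : Measurable fun b => (Q b).det :=
    (Continuous.matrix_det (A := fun q : ι → ι → ℝ => Matrix.of q) (by fun_prop)).measurable.comp hQ'
  have hadj : ∀ i j, Measurable fun b => (Q b).adjugate i j := fun i j =>
    (((Continuous.matrix_adjugate (A := fun q : ι → ι → ℝ => Matrix.of q)
      (by fun_prop)).matrix_elem i j).measurable.comp hQ')
  have hinv : ∀ i j, Measurable fun b => (Q b)⁻¹ i j := by
    intro i j
    -- The formula `Q⁻¹ = (det Q)⁻¹ • adjugate Q` also covers singular `Q`, where both sides are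
    -- `0`, so no invertibility is needed.
    simp only [Matrix.inv_def, Ring.inverse_eq_inv', Matrix.smul_apply, smul_eq_mul]
    exact hdet.inv.mul (hadj i j)
  unfold gaussianDensity
  simp only [dotProduct, Matrix.mulVec, Pi.sub_apply]
  refine ENNReal.measurable_ofReal.comp (Measurable.mul ?_ ?_)
  · fun_prop
  · refine Real.measurable_exp.comp (measurable_const.mul ?_)
    refine Finset.measurable_sum _ fun i _ => ((hz i).sub (hm i)).mul ?_
    exact Finset.measurable_sum _ fun j _ => (hinv i j).mul ((hz j).sub (hm j))

end GaussianDensity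

/-! ### Gaussian subspaces of `L²` and stochastic integrals. -/

section GaussianSpace

variable {Ω : Type*} {mΩ : MeasurableSpace Ω} {P : Measure Ω}

/-- `Y` is a square integrable random variable whose class belongs to the subspace `H` of `L²`. -/
def RepresentsMem (H : Submodule ℝ (Lp ℝ 2 P)) (Y : Ω → ℝ) : Prop :=
  ∃ h : MemLp Y 2 P, h.toLp Y ∈ H

namespace RepresentsMem

variable {H : Submodule ℝ (Lp ℝ 2 P)} {Y Z : Ω → ℝ}

lemma memLp (h : RepresentsMem H Y) : MemLp Y 2 P := h.1

lemma of_mem {y : Lp ℝ 2 P} (hy : y ∈ H) : RepresentsMem H y :=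
  ⟨Lp.memLp y, by rwa [Lp.toLp_coeFn]⟩

lemma congr (h : RepresentsMem H Y) (hYZ : Y =ᵐ[P] Z) : RepresentsMem H Z :=
  ⟨(memLp_congr_ae hYZ).1 h.1, by
    rw [← MemLp.toLp_congr h.1 _ hYZ]; exact h.2⟩

lemma add (hY : RepresentsMem H Y) (hZ : RepresentsMem H Z) :
    RepresentsMem H (fun ω => Y ω + Z ω) :=
  ⟨hY.1.add hZ.1, by
    have := H.add_mem hY.2 hZ.2
    rwa [← MemLp.toLp_add] at this⟩

lemma sub (hY : RepresentsMem H Y) (hZ : RepresentsMem H Z) :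
    RepresentsMem H (fun ω => Y ω - Z ω) :=
  ⟨hY.1.sub hZ.1, by
    have := H.sub_mem hY.2 hZ.2
    rwa [← MemLp.toLp_sub] at this⟩

lemma const_mul (c : ℝ) (hY : RepresentsMem H Y) : RepresentsMem H (fun ω => c * Y ω) :=
  ⟨hY.1.const_mul c, by
    have := H.smul_mem c hY.2
    rwa [← MemLp.toLp_const_smul] at this⟩

lemma zero : RepresentsMem H (fun _ => 0) := by
  refine (of_mem (zero_mem H)).congr ?_
  filter_upwards [Lp.coeFn_zero ℝ 2 P] with ω hω using hω

lemma sum {κ : Type*} (I : Finset κ) {Y : κ → Ω → ℝ} (hY : ∀ k ∈ I, RepresentsMem H (Y k)) :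
    RepresentsMem H (fun ω => ∑ k ∈ I, Y k ω) := by
  classical
  induction I using Finset.induction_on with
  | empty => simpa using zero
  | insert a s ha ih =>
    simp only [Finset.sum_insert ha]
    exact (hY a (Finset.mem_insert_self _ _)).add
      (ih fun k hk => hY k (Finset.mem_insert_of_mem hk))

end RepresentsMem

/-- A closed subspace of `L²` consisting of centered Gaussian variables. -/
structure IsGaussianSpace (H : Submodule ℝ (Lp ℝ 2 P)) : Prop where
  isClosed : IsClosed (H : Set (Lp ℝ 2 P))
  integral_eq_zero : ∀ y ∈ H, ∫ ω, y ω ∂P = 0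
  integral_exp : ∀ y ∈ H, ∫ ω, Complex.exp ((y ω : ℂ) * Complex.I) ∂P =
    Complex.exp (-((‖y‖ ^ 2 : ℝ) / 2 : ℂ))

lemma norm_toLp_sq {Y : Ω → ℝ} (hY : MemLp Y 2 P) : ‖hY.toLp Y‖ ^ 2 = ∫ ω, Y ω ^ 2 ∂P := by
  rw [← real_inner_self_eq_norm_sq, L2.inner_def]
  refine integral_congr_ae ?_
  filter_upwards [hY.coeFn_toLp] with ω hω
  simp [hω, sq]

lemma inner_toLp {Y Z : Ω → ℝ} (hY : MemLp Y 2 P) (hZ : MemLp Z 2 P) :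
    inner ℝ (hY.toLp Y) (hZ.toLp Z) = ∫ ω, Y ω * Z ω ∂P := by
  rw [L2.inner_def]
  refine integral_congr_ae ?_
  filter_upwards [hY.coeFn_toLp, hZ.coeFn_toLp] with ω hω hω'
  simp [hω, hω', mul_comm]

namespace IsGaussianSpace

variable {H : Submodule ℝ (Lp ℝ 2 P)} {Y : Ω → ℝ}

lemma integral_eq_zero_of_representsMem (hH : IsGaussianSpace H) (hY : RepresentsMem H Y) :
    ∫ ω, Y ω ∂P = 0 := by
  rw [← hH.integral_eq_zero _ hY.2]
  exact integral_congr_ae hY.1.coeFn_toLp.symm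

lemma integral_exp_of_representsMem (hH : IsGaussianSpace H) (hY : RepresentsMem H Y) :
    ∫ ω, Complex.exp ((Y ω : ℂ) * Complex.I) ∂P =
      Complex.exp (-((∫ ω, Y ω ^ 2 ∂P : ℝ) / 2 : ℂ)) := by
  rw [← norm_toLp_sq hY.1, ← hH.integral_exp _ hY.2]
  refine integral_congr_ae ?_
  filter_upwards [hY.1.coeFn_toLp] with ω hω
  rw [hω]

variable [IsProbabilityMeasure P]

/-- In a Gaussian space, convergence in probability forces convergence in `L²`: the characteristic
function at `1` of a difference is `exp (-‖·‖² / 2)`, so its convergence to `1` makes the sequence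
Cauchy. -/
lemma representsMem_of_tendstoInMeasure (hH : IsGaussianSpace H) {Z : ℕ → Ω → ℝ}
    (hZ : ∀ n, RepresentsMem H (Z n)) (h : TendstoInMeasure P Z atTop Y) :
    RepresentsMem H Y := by
  obtain ⟨ns, hns, hae⟩ := h.exists_seq_tendsto_ae
  set z : ℕ → Lp ℝ 2 P := fun k => (hZ (ns k)).1.toLp (Z (ns k)) with hz
  have hzH : ∀ k, z k ∈ H := fun k => (hZ (ns k)).2
  have hlim : Tendsto (fun p : ℕ × ℕ => ∫ ω, Complex.exp (((z p.1 - z p.2 : Lp ℝ 2 P) ω : ℂ) *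
      Complex.I) ∂P) atTop (𝓝 (∫ ω, 1 ∂P)) := by
    refine tendsto_integral_filter_of_dominated_convergence (fun _ => 1) ?_ ?_
      (integrable_const _) ?_
    · refine Eventually.of_forall fun p => ?_
      have := Lp.aestronglyMeasurable (z p.1 - z p.2)
      exact (by fun_prop : Continuous fun x : ℝ => Complex.exp ((x : ℂ) * Complex.I))
        |>.comp_aestronglyMeasurable this
    · refine Eventually.of_forall fun p => Eventually.of_forall fun ω => ?_
      rw [Complex.norm_exp_ofReal_mul_I]
    · have h1 : ∀ᵐ ω ∂P, ∀ p : ℕ × ℕ,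
          (z p.1 - z p.2 : Lp ℝ 2 P) ω = Z (ns p.1) ω - Z (ns p.2) ω := by
        rw [ae_all_iff]
        intro p
        filter_upwards [Lp.coeFn_sub (z p.1) (z p.2), (hZ (ns p.1)).1.coeFn_toLp,
          (hZ (ns p.2)).1.coeFn_toLp] with ω h1 h2 h3
        rw [h1, Pi.sub_apply, hz, h2, h3]
      filter_upwards [hae, h1] with ω hω h1
      simp only [h1]
      have h2 : Tendsto (fun p : ℕ × ℕ => Z (ns p.1) ω - Z (ns p.2) ω) atTop (𝓝 0) := by
        rw [← prod_atTop_atTop_eq]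
        simpa using (hω.comp tendsto_fst).sub (hω.comp tendsto_snd)
      have h3 : Continuous fun x : ℝ => Complex.exp ((x : ℂ) * Complex.I) := by fun_prop
      simpa [Function.comp_def] using (h3.tendsto 0).comp h2
  have hcauchy : CauchySeq z := by
    rw [cauchySeq_iff_tendsto_dist_atTop_0]
    have h1 : ∀ p : ℕ × ℕ, ∫ ω, Complex.exp (((z p.1 - z p.2 : Lp ℝ 2 P) ω : ℂ) *
        Complex.I) ∂P = (Real.exp (-(‖z p.1 - z p.2‖ ^ 2 / 2)) : ℝ) := by
      intro p
      rw [hH.integral_exp _ (H.sub_mem (hzH _) (hzH _))]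
      push_cast; rfl
    -- Taking logarithms turns the limit `1` into convergence of the distances to `0`.
    simp_rw [h1] at hlim
    have h2 := (Complex.continuous_re.tendsto _).comp hlim
    simp only [Function.comp_def, Complex.ofReal_re, integral_const, probReal_univ, one_smul,
      Complex.one_re] at h2
    have h3 := h2.log one_ne_zero
    simp only [Real.log_exp, Real.log_one] at h3
    have h4 := (h3.const_mul (-2)).sqrt
    simp only [mul_zero, Real.sqrt_zero] at h4
    refine h4.congr fun p => ?_
    rw [show -2 * -(‖z p.1 - z p.2‖ ^ 2 / 2) = ‖z p.1 - z p.2‖ ^ 2 by ring,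
      Real.sqrt_sq (norm_nonneg _), dist_eq_norm]
  obtain ⟨y, hy⟩ := cauchySeq_tendsto_of_complete hcauchy
  have hyH : y ∈ H := hH.isClosed.mem_of_tendsto hy (Eventually.of_forall hzH)
  refine (RepresentsMem.of_mem hyH).congr ?_
  refine tendstoInMeasure_ae_unique (tendstoInMeasure_of_tendsto_Lp hy) ?_
  have h5 : TendstoInMeasure P (fun k => Z (ns k)) atTop Y :=
    fun ε hε => (h ε hε).comp hns.tendsto_atTop
  exact h5.congr (fun k => (hZ (ns k)).1.coeFn_toLp.symm) (ae_eq_refl _)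

lemma isGaussianProcess (hH : IsGaussianSpace H) {σ : Type*} {Y : σ → Ω → ℝ}
    (hY : ∀ s, RepresentsMem H (Y s)) : IsGaussianProcess Y P where
  hasGaussianLaw I := by
    classical
    have hm : AEMeasurable (fun ω => I.restrict (Y · ω)) P :=
      aemeasurable_pi_lambda _ fun s => (hY s).1.aestronglyMeasurable.aemeasurable
    rw [hasGaussianLaw_iff_charFunDual_map_eq hm]
    intro L
    have hLmem : RepresentsMem H (fun ω => L (I.restrict (Y · ω))) := by
      have := RepresentsMem.sum (H := H) Finset.univ
        (Y := fun (i : I) ω => L (fun j => if i = j then 1 else 0) * Y i ω)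
        fun i _ => (hY i).const_mul _
      refine this.congr (Eventually.of_forall fun ω => ?_)
      refine Eq.symm ((LinearMap.pi_apply_eq_sum_univ (L : (I → ℝ) →ₗ[ℝ] ℝ) _).trans ?_)
      simp [mul_comm]
    have h0 := hH.integral_eq_zero_of_representsMem hLmem
    rw [charFunDual_apply, integral_map hm (by fun_prop), hH.integral_exp_of_representsMem hLmem]
    simp only [Function.comp_def]
    rw [variance_eq_integral hLmem.1.aestronglyMeasurable.aemeasurable, h0]
    simp

end IsGaussianSpace

/-- The Gaussian space of a square integrable process: the closed linear span in `L²`. -/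
def gaussianSpace {σ : Type*} {X : σ → Ω → ℝ} (hX : ∀ t, MemLp (X t) 2 P) :
    Submodule ℝ (Lp ℝ 2 P) :=
  (Submodule.span ℝ (Set.range fun t => (hX t).toLp (X t))).topologicalClosure

lemma representsMem_gaussianSpace {σ : Type*} {X : σ → Ω → ℝ} (hX : ∀ t, MemLp (X t) 2 P) (t : σ) :
    RepresentsMem (gaussianSpace hX) (X t) :=
  ⟨hX t, Submodule.le_topologicalClosure _ (Submodule.subset_span ⟨t, rfl⟩)⟩

/-- Being centered is orthogonality to the constant `1`, a closed condition. The characteristic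
function is known on the span by joint Gaussianity and passes to `L²` limits by dominated
convergence along an almost surely convergent subsequence. -/
lemma isGaussianSpace_gaussianSpace [IsProbabilityMeasure P] {σ : Type*} {X : σ → Ω → ℝ}
    (hG : IsGaussianProcess X P) (hX : ∀ t, MemLp (X t) 2 P) (hc : ∀ t, ∫ ω, X t ω ∂P = 0) :
    IsGaussianSpace (gaussianSpace hX) := by
  have hint : ∀ y ∈ gaussianSpace hX, ∫ ω, y ω ∂P = 0 := by
    intro y hy
    have h1 : MemLp (fun _ : Ω => (1 : ℝ)) 2 P := memLp_const 1
    have h2 : gaussianSpace hX ≤ (ℝ ∙ h1.toLp _)ᗮ := by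
      refine Submodule.topologicalClosure_minimal _ ?_ (Submodule.isClosed_orthogonal _)
      rw [Submodule.span_le]
      rintro _ ⟨t, rfl⟩
      rw [SetLike.mem_coe, Submodule.mem_orthogonal_singleton_iff_inner_right, inner_toLp]
      simpa using hc t
    have h3 := Submodule.mem_orthogonal_singleton_iff_inner_right.1 (h2 hy)
    rw [← Lp.toLp_coeFn y (Lp.memLp y), inner_toLp] at h3
    simpa using h3
  refine ⟨Submodule.isClosed_topologicalClosure _, hint, ?_⟩
  have hspan : ∀ y ∈ Submodule.span ℝ (Set.range fun t => (hX t).toLp (X t)),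
      ∫ ω, Complex.exp ((y ω : ℂ) * Complex.I) ∂P = Complex.exp (-((‖y‖ ^ 2 : ℝ) / 2 : ℂ)) := by
    intro y hy
    have hy0 := hint y (Submodule.le_topologicalClosure _ hy)
    obtain ⟨c, hc⟩ := Finsupp.mem_span_range_iff_exists_finsupp.1 hy
    have hyc : (fun ω => ∑ t ∈ c.support, c t • X t ω) =ᵐ[P] y := by
      have h1 : ∀ᵐ ω ∂P, ∀ t ∈ c.support, ((c t • (hX t).toLp (X t) : Lp ℝ 2 P)) ω = c t • X t ω := by
        rw [Finset.eventually_all]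
        intro t _
        filter_upwards [Lp.coeFn_smul (c t) ((hX t).toLp (X t)), (hX t).coeFn_toLp] with ω h1 h2
        rw [h1, Pi.smul_apply, h2]
      have h2 : y =ᵐ[P] fun ω => ∑ t ∈ c.support, (c t • (hX t).toLp (X t) : Lp ℝ 2 P) ω := by
        rw [← hc, Finsupp.sum]
        have := Lp.coeFn_finsetSum c.support (fun t => (c t • (hX t).toLp (X t) : Lp ℝ 2 P))
        filter_upwards [this] with ω hω
        simpa using hω
      filter_upwards [h1, h2] with ω h1 h2
      rw [h2]
      exact Finset.sum_congr rfl fun t ht => (h1 t ht).symm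
    have hlaw : HasGaussianLaw y P :=
      (IsGaussianProcess.hasGaussianLaw_fun_sum (X := fun t ω => c t • X t ω) (hG.of_isGaussianProcess
        fun t => ⟨{t}, c t • ContinuousLinearMap.proj ⟨t, by simp⟩, fun ω => by simp⟩)).congr hyc
    have h3 := hlaw.charFunDual_map_eq (ContinuousLinearMap.id ℝ ℝ)
    rw [charFunDual_apply, integral_map hlaw.aemeasurable (by fun_prop)] at h3
    simp only [ContinuousLinearMap.id_apply, Function.comp_def] at h3
    rw [h3, variance_eq_integral hlaw.aemeasurable, hy0, ← Lp.toLp_coeFn y (Lp.memLp y), norm_toLp_sq]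
    simp only [Complex.ofReal_zero, zero_mul, zero_sub, sub_zero, Lp.toLp_coeFn]
  intro y hy
  obtain ⟨u, hu, huy⟩ := mem_closure_iff_seq_limit.1 hy
  obtain ⟨ns, hns, hae⟩ := (tendstoInMeasure_of_tendsto_Lp huy).exists_seq_tendsto_ae
  have h3 : Continuous fun x : ℝ => Complex.exp ((x : ℂ) * Complex.I) := by fun_prop
  have h1 : Tendsto (fun k => ∫ ω, Complex.exp ((u (ns k) ω : ℂ) * Complex.I) ∂P) atTop
      (𝓝 (∫ ω, Complex.exp ((y ω : ℂ) * Complex.I) ∂P)) := by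
    refine tendsto_integral_of_dominated_convergence (fun _ => 1) ?_ (integrable_const _) ?_ ?_
    · exact fun k => h3.comp_aestronglyMeasurable (Lp.aestronglyMeasurable _)
    · exact fun k => Eventually.of_forall fun ω => by rw [Complex.norm_exp_ofReal_mul_I]
    · filter_upwards [hae] with ω hω using (h3.tendsto _).comp hω
  simp_rw [hspan _ (hu _)] at h1
  refine tendsto_nhds_unique h1 ?_
  have h4 : Continuous fun y : Lp ℝ 2 P => Complex.exp (-((‖y‖ ^ 2 : ℝ) / 2 : ℂ)) := by fun_prop
  exact (h4.tendsto y).comp (huy.comp hns.tendsto_atTop)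

/-- Induction on the rules generating the integral: all are linear except the limit in probability,
under which a Gaussian space is stable. -/
lemma HasIntegral.representsMem [IsProbabilityMeasure P] {T : ℝ≥0} {X : Set.Iic T → Ω → ℝ}
    {H : Submodule ℝ (Lp ℝ 2 P)} (hH : IsGaussianSpace H) (hX : ∀ t, RepresentsMem H (X t))
    {f : Set.Iic T → ℝ} {Z : Ω → ℝ} (h : HasIntegral X P f Z) : RepresentsMem H Z := by
  induction h with
  | step a b _ => exact (hX b).sub (hX a)
  | add _ _ h₁ h₂ => exact h₁.add h₂
  | smul c _ h => exact h.const_mul c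
  | congr_pos _ _ h => exact h
  | lim C _ _ _ hZ h => exact hH.representsMem_of_tendstoInMeasure h hZ

end GaussianSpace

/-! ### Gaussian regression and conditional laws. -/

section GaussianConditioning

variable {Ω : Type*} {mΩ : MeasurableSpace Ω} {P : Measure Ω}
  {H : Submodule ℝ (Lp ℝ 2 P)}

/-- Regression of elements of a Gaussian space on a process in this space: the residuals are
orthogonal to the regression functions and independent of the process. -/
lemma IsGaussianSpace.exists_regression [IsProbabilityMeasure P] (hH : IsGaussianSpace H) {σ ι : Type*} {X : σ → Ω → ℝ}
    (hXm : ∀ u, Measurable (X u)) (hX : ∀ u, RepresentsMem H (X u)) {Z : ι → Ω → ℝ}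
    (hZ : ∀ i, RepresentsMem H (Z i)) :
    ∃ W : ι → (σ → ℝ) → ℝ, (∀ i, Measurable (W i)) ∧
      (∀ i, RepresentsMem H fun ω => W i fun u => X u ω) ∧
      (∀ i j, ∫ ω, (Z i ω - W i fun u => X u ω) * (W j fun u => X u ω) ∂P = 0) ∧
      IndepFun (fun ω i => Z i ω - W i fun u => X u ω) (fun ω u => X u ω) P := by
  set K := gaussianSpace fun u => (hX u).1 with hK
  have hKH : K ≤ H := by
    refine Submodule.topologicalClosure_minimal _ ?_ hH.isClosed
    rw [Submodule.span_le]
    rintro _ ⟨u, rfl⟩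
    exact (hX u).2
  have : CompleteSpace K := (Submodule.isClosed_topologicalClosure _).completeSpace_coe
  have hpm : Measurable fun ω u => X u ω := measurable_pi_lambda _ hXm
  -- Path-measurable classes form a closed subspace of `L²`, so the projection onto `K` is a
  -- measurable function of the path up to a null set.
  have hKm : ∀ y ∈ K, AEStronglyMeasurable[MeasurableSpace.comap (fun ω u => X u ω) inferInstance] y P := by
    have : K ≤ lpMeas ℝ ℝ (MeasurableSpace.comap (fun ω u => X u ω) inferInstance) 2 P := by
      refine Submodule.topologicalClosure_minimal _ ?_ (isClosed_aestronglyMeasurable hpm.comap_le)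
      rw [Submodule.span_le]
      rintro _ ⟨u, rfl⟩
      refine mem_lpMeas_iff_aestronglyMeasurable.2
        (AEStronglyMeasurable.congr ?_ (hX u).1.coeFn_toLp.symm)
      exact ((measurable_pi_apply u).comp
        (comap_measurable (fun ω u => X u ω))).stronglyMeasurable.aestronglyMeasurable
    exact fun y hy => mem_lpMeas_iff_aestronglyMeasurable.1 (this hy)
  set w : ι → Lp ℝ 2 P := fun i => K.starProjection ((hZ i).1.toLp (Z i)) with hw
  have hwK : ∀ i, w i ∈ K := fun i => K.starProjection_apply_mem _
  have hfac : ∀ i, ∃ h : (σ → ℝ) → ℝ, Measurable h ∧ w i =ᵐ[P] fun ω => h fun u => X u ω := by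
    intro i
    obtain ⟨g, hg, hwg⟩ := hKm _ (hwK i)
    obtain ⟨h, hh, rfl⟩ := hg.measurable.exists_eq_measurable_comp
    exact ⟨h, hh, hwg⟩
  choose W hWm hWw using hfac
  have hWK : ∀ i, RepresentsMem K fun ω => W i fun u => X u ω :=
    fun i => (RepresentsMem.of_mem (hwK i)).congr (hWw i)
  have hWH : ∀ i, RepresentsMem H fun ω => W i fun u => X u ω :=
    fun i => ⟨(hWK i).1, hKH (hWK i).2⟩
  have hR : ∀ i, RepresentsMem H fun ω => Z i ω - W i fun u => X u ω := fun i => (hZ i).sub (hWH i)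
  have horth : ∀ i {Y : Ω → ℝ}, RepresentsMem K Y →
      ∫ ω, (Z i ω - W i fun u => X u ω) * Y ω ∂P = 0 := by
    intro i Y hY
    rw [← inner_toLp (hR i).1 hY.1, real_inner_comm]
    have h1 : (hR i).1.toLp _ = (hZ i).1.toLp (Z i) - w i := by
      have h2 : w i = (hWK i).1.toLp _ := by
        rw [← Lp.toLp_coeFn (w i) (Lp.memLp _)]
        exact MemLp.toLp_congr _ _ (hWw i)
      rw [h2]
      exact MemLp.toLp_sub (hZ i).1 (hWK i).1
    rw [h1]
    exact K.sub_starProjection_mem_orthogonal _ _ hY.2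
  refine ⟨W, hWm, hWH, fun i j => horth i (hWK j), ?_⟩
  -- Residuals and process together lie in `H`, hence are jointly Gaussian, and zero covariance
  -- becomes independence.
  have hproc : IsGaussianProcess (Sum.elim (fun i ω => Z i ω - W i fun u => X u ω) X) P := by
    refine hH.isGaussianProcess ?_
    rintro (i | u)
    · exact hR i
    · exact hX u
  refine hproc.indepFun_of_covariance_eq_zero
    (fun i => (hR i).1.aestronglyMeasurable.aemeasurable) (fun u => (hXm u).aemeasurable) ?_
  intro i u
  rw [covariance, hH.integral_eq_zero_of_representsMem (hR i),
    hH.integral_eq_zero_of_representsMem (hX u)]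
  simpa using horth i (representsMem_gaussianSpace (fun u => (hX u).1) u)

lemma condExp_eq_integral_of_indep [IsProbabilityMeasure P] {σ κ : Type*} [MeasurableSpace σ] [MeasurableSpace κ]
    {p : Ω → σ} {R : Ω → κ} (hp : Measurable p) (hR : Measurable R) (hind : IndepFun R p P)
    {φ : κ → ℝ} (hφ : Measurable φ) :
    P[fun ω => φ (R ω) | MeasurableSpace.comap p inferInstance] =ᵐ[P]
      fun _ => ∫ ω, φ (R ω) ∂P :=
  condExp_indep_eq hR.comap_le hp.comap_le
    (hφ.comp (comap_measurable R)).stronglyMeasurable ((IndepFun_iff_Indep _ _ _).1 hind)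

lemma condExp_of_regression [IsProbabilityMeasure P] {σ ι : Type*} [MeasurableSpace σ] {p : Ω → σ} (hp : Measurable p)
    {Z : ι → Ω → ℝ} {W : ι → σ → ℝ} (hWm : ∀ i, Measurable (W i)) (hZm : ∀ i, Measurable (Z i))
    (hZi : ∀ i, Integrable (Z i) P) (hWi : ∀ i, Integrable (fun ω => W i (p ω)) P)
    (h0 : ∀ i, ∫ ω, (Z i ω - W i (p ω)) ∂P = 0)
    (hind : IndepFun (fun ω i => Z i ω - W i (p ω)) p P) (i : ι) :
    P[Z i | MeasurableSpace.comap p inferInstance] =ᵐ[P] fun ω => W i (p ω) := by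
  have hRm : Measurable (fun ω i => Z i ω - W i (p ω)) :=
    measurable_pi_lambda _ fun i => (hZm i).sub ((hWm i).comp hp)
  have h1 := condExp_eq_integral_of_indep hp hRm hind (measurable_pi_apply i)
  simp only [h0] at h1
  have h2 : Z i = (fun ω => Z i ω - W i (p ω)) + fun ω => W i (p ω) := by ext; simp
  have h3 : P[fun ω => W i (p ω) | MeasurableSpace.comap p inferInstance] = fun ω => W i (p ω) :=
    condExp_of_stronglyMeasurable hp.comap_le
      ((hWm i).comp (comap_measurable p)).stronglyMeasurable (hWi i)
  have h4 := condExp_add ((hZi i).sub (hWi i)) (hWi i) (MeasurableSpace.comap p inferInstance)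
  have h5 : P[Z i | MeasurableSpace.comap p inferInstance] =
    P[(fun ω => Z i ω - W i (p ω)) + fun ω => W i (p ω) | MeasurableSpace.comap p inferInstance] := by
    rw [← h2]
  rw [h5]
  filter_upwards [h4, h1] with ω h4 h1
  refine h4.trans ?_
  rw [Pi.add_apply, h3]
  exact (congrArg (· + W i (p ω)) h1).trans (zero_add _)

/-- The centered variables are the residuals, which are independent of `p`; this is why the
conditional covariance is not random. -/
lemma condCovMatrix_of_regression [IsProbabilityMeasure P] {σ ι : Type*} [Countable ι] [MeasurableSpace σ] {p : Ω → σ}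
    (hp : Measurable p) {Z : ι → Ω → ℝ} {W : ι → σ → ℝ} (hWm : ∀ i, Measurable (W i))
    (hZm : ∀ i, Measurable (Z i))
    (hZi : ∀ i, Integrable (Z i) P) (hWi : ∀ i, Integrable (fun ω => W i (p ω)) P)
    (h0 : ∀ i, ∫ ω, (Z i ω - W i (p ω)) ∂P = 0)
    (hind : IndepFun (fun ω i => Z i ω - W i (p ω)) p P) :
    ∀ᵐ ω ∂P, condCovMatrix Z P (MeasurableSpace.comap p inferInstance) ω =
      Matrix.of fun i j => ∫ ω, (Z i ω - W i (p ω)) * (Z j ω - W j (p ω)) ∂P := by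
  have hRm : Measurable (fun ω i => Z i ω - W i (p ω)) :=
    measurable_pi_lambda _ fun i => (hZm i).sub ((hWm i).comp hp)
  have hc := condExp_of_regression hp hWm hZm hZi hWi h0 hind
  have h : ∀ i j, ∀ᵐ ω ∂P, condCovMatrix Z P (MeasurableSpace.comap p inferInstance) ω i j =
      ∫ ω, (Z i ω - W i (p ω)) * (Z j ω - W j (p ω)) ∂P := by
    intro i j
    have h1 := condExp_eq_integral_of_indep hp hRm hind (φ := fun r => r i * r j) (by fun_prop)
    refine EventuallyEq.trans (condExp_congr_ae ?_) h1
    filter_upwards [hc i, hc j] with ω hi hj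
    rw [hi, hj]
  filter_upwards [ae_all_iff.2 fun i => ae_all_iff.2 fun j => h i j] with ω hω
  ext i j
  exact hω i j

/-- By independence, the law of `(p, Z)` is the image of a product measure under `(x, r) ↦ (x, W x +
r)`; uniqueness of disintegration then identifies the conditional law. -/
lemma condDistrib_of_regression [IsProbabilityMeasure P] {σ ι : Type*} [Fintype ι] [MeasurableSpace σ] {p : Ω → σ}
    (hp : Measurable p) {Z : Ω → ι → ℝ} {W : σ → ι → ℝ} (hWm : Measurable W) (hZm : Measurable Z)
    (hind : IndepFun (fun ω => Z ω - W (p ω)) p P) :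
    ∀ᵐ ω ∂P, condDistrib Z p P (p ω) =
      (P.map fun ω => Z ω - W (p ω)).map fun r => W (p ω) + r := by
  set ν := P.map fun ω => Z ω - W (p ω) with hν
  have hRm : Measurable fun ω => Z ω - W (p ω) := hZm.sub (hWm.comp hp)
  have : IsProbabilityMeasure ν := Measure.isProbabilityMeasure_map hRm.aemeasurable
  have : IsProbabilityMeasure (P.map p) := Measure.isProbabilityMeasure_map hp.aemeasurable
  have hf : Measurable fun q : σ × (ι → ℝ) => W q.1 + q.2 := by fun_prop
  set κ : Kernel σ (ι → ℝ) := (Kernel.id ×ₖ Kernel.const σ ν).map fun q => W q.1 + q.2 with hκ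
  have hκa : ∀ x, κ x = ν.map fun r => W x + r := by
    intro x
    rw [hκ, Kernel.map_apply _ hf, Kernel.prod_apply, Kernel.id_apply, Kernel.const_apply,
      Measure.dirac_prod, Measure.map_map hf (by fun_prop)]
    rfl
  have : IsMarkovKernel κ := Kernel.IsMarkovKernel.map _ hf
  have hjoint : P.map (fun ω => (p ω, Z ω)) = P.map p ⊗ₘ κ := by
    have h1 := (indepFun_iff_map_prod_eq_prod_map_map hp.aemeasurable hRm.aemeasurable).1 hind.symm
    have hg : Measurable fun q : σ × (ι → ℝ) => (q.1, W q.1 + q.2) := by fun_prop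
    have h2 : P.map (fun ω => (p ω, Z ω)) =
        ((P.map p).prod ν).map fun q => (q.1, W q.1 + q.2) := by
      rw [hν, ← h1, Measure.map_map hg (hp.prodMk hRm)]
      congr 1
      ext ω <;> simp
    ext s hs
    rw [h2, Measure.map_apply hg hs, Measure.prod_apply (hg hs), Measure.compProd_apply hs]
    refine lintegral_congr fun x => ?_
    rw [hκa, Measure.map_apply (by fun_prop) (measurable_prodMk_left hs)]
    rfl
  have := condDistrib_ae_eq_of_measure_eq_compProd p hZm.aemeasurable hjoint
  filter_upwards [ae_of_ae_map hp.aemeasurable this] with ω hω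
  rw [hω, hκa]

section MomentMatrix

variable {ι : Type*} [Fintype ι] {V : ι → Ω → ℝ}

lemma dotProduct_momentMatrix_mulVec (hV : ∀ i, MemLp (V i) 2 P) (x : ι → ℝ) :
    x ⬝ᵥ (Matrix.of fun i j => ∫ ω, V i ω * V j ω ∂P).mulVec x =
      ∫ ω, (∑ i, x i * V i ω) ^ 2 ∂P := by
  have hint : ∀ i j, Integrable (fun ω => V i ω * V j ω) P := fun i j => (hV i).integrable_mul (hV j)
  have h1 : ∀ ω, (∑ i, x i * V i ω) ^ 2 = ∑ i, ∑ j, x i * x j * (V i ω * V j ω) := by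
    intro ω
    rw [sq, Finset.sum_mul_sum]
    exact Finset.sum_congr rfl fun i _ => Finset.sum_congr rfl fun j _ => by ring
  simp_rw [h1]
  rw [integral_finsetSum _ fun i _ => integrable_finsetSum _ fun j _ => (hint i j).const_mul _]
  simp only [dotProduct, Matrix.mulVec, Finset.mul_sum, Matrix.of_apply]
  refine Finset.sum_congr rfl fun i _ => ?_
  rw [integral_finsetSum _ fun j _ => (hint i j).const_mul _]
  refine Finset.sum_congr rfl fun j _ => ?_
  rw [integral_const_mul]
  ring

lemma posSemidef_momentMatrix (hV : ∀ i, MemLp (V i) 2 P) :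
    (Matrix.of fun i j => ∫ ω, V i ω * V j ω ∂P).PosSemidef := by
  refine Matrix.PosSemidef.of_dotProduct_mulVec_nonneg ?_ fun x => ?_
  · ext i j
    simp [mul_comm]
  · rw [star_trivial, dotProduct_momentMatrix_mulVec hV]
    positivity

lemma IsGaussianSpace.map_eq_withDensity [IsProbabilityMeasure P] [DecidableEq ι]
    (hH : IsGaussianSpace H)
    (hVm : ∀ i, Measurable (V i)) (hV : ∀ i, RepresentsMem H (V i))
    (hQ : (Matrix.of fun i j => ∫ ω, V i ω * V j ω ∂P).PosDef) :
    P.map (fun ω i => V i ω) =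
      volume.withDensity (gaussianDensity 0 (Matrix.of fun i j => ∫ ω, V i ω * V j ω ∂P)) := by
  have hm : Measurable fun ω i => V i ω := measurable_pi_lambda _ hVm
  have := Measure.isProbabilityMeasure_map (μ := P) hm.aemeasurable
  refine eq_withDensity_gaussianDensity hQ fun x => ?_
  rw [integral_map hm.aemeasurable (by fun_prop), dotProduct_momentMatrix_mulVec fun i => (hV i).1]
  exact hH.integral_exp_of_representsMem
    (RepresentsMem.sum Finset.univ fun i _ => (hV i).const_mul (x i))

end MomentMatrix

end GaussianConditioning

/-! ### Bayes' formula on a sub-σ-algebra. -/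

section Trim

variable {Ω : Type*} {m m0 : MeasurableSpace Ω} (hm : m ≤ m0) {P ν : Measure Ω} {f : Ω → ℝ≥0∞}

lemma trim_eq_withDensity (hf : Measurable[m] f)
    (h : ∀ A, MeasurableSet[m] A → ν A = ∫⁻ ω in A, f ω ∂P) :
    ν.trim hm = (P.trim hm).withDensity f := by
  refine @Measure.ext _ m _ _ fun A hA => ?_
  rw [trim_measurableSet_eq hm hA, withDensity_apply _ hA, setLIntegral_trim hm hf hA, h A hA]

lemma ae_trim_of_ae_ne_zero (hf : Measurable[m] f) (h : ∀ᵐ ω ∂P, f ω ≠ 0) :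
    ∀ᵐ ω ∂(P.trim hm), f ω ≠ 0 := by
  rw [ae_iff] at h ⊢
  have hs : MeasurableSet[m] {ω | ¬f ω ≠ 0} := by
    simpa only [not_not] using! hf (measurableSet_singleton 0)
  rwa [trim_measurableSet_eq hm hs]

end Trim

section Bayes

variable {Ω E σ : Type*} {m' mΩ : MeasurableSpace Ω} [MeasurableSpace E] [MeasurableSpace σ]
  {P : Measure Ω} [IsProbabilityMeasure P] {ν : Measure E} {p : Ω → σ} {Z : Ω → E}
  {D : Ω → E → ℝ≥0∞} {D₀ : E → ℝ≥0∞} {κ : Kernel E Ω}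

/-- This makes division by `D₀ z` legitimate: a density is almost surely nonzero under its own
measure, and finite because the total mass is. -/
lemma ae_ne_zero_and_ne_top_of_map_eq (hZ : Measurable Z) (hD₀ : Measurable D₀)
    (hD₀Z : P.map Z = ν.withDensity D₀) : ∀ᵐ z ∂(P.map Z), D₀ z ≠ 0 ∧ D₀ z ≠ ∞ := by
  have := Measure.isProbabilityMeasure_map (μ := P) hZ.aemeasurable
  have h0 : ∀ᵐ z ∂(P.map Z), D₀ z ≠ 0 := by
    rw [hD₀Z, ae_withDensity_iff hD₀]
    exact Eventually.of_forall fun z hz => hz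
  have h1 : ∀ᵐ z ∂(P.map Z), D₀ z ≠ ∞ := by
    have h2 : ∀ᵐ z ∂ν, D₀ z < ∞ := by
      refine ae_lt_top hD₀ ?_
      rw [← setLIntegral_univ, ← withDensity_apply _ MeasurableSet.univ, ← hD₀Z]
      exact measure_ne_top _ _
    rw [hD₀Z]
    filter_upwards [(withDensity_absolutelyContinuous ν D₀).ae_le h2] with z hz using hz.ne
  exact h0.and h1

variable [SigmaFinite ν]

/-- Bayes' formula for a single event. -/
lemma ae_condProb_eq_setLIntegral [StandardBorelSpace E] [Nonempty E]
    (hp : Measurable p) (hZ : Measurable Z)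
    (hD : Measurable (Function.uncurry D))
    (hDp : ∀ᵐ ω ∂P, condDistrib Z p P (p ω) = ν.withDensity (D ω))
    (hD₀ : Measurable D₀) (hD₀Z : P.map Z = ν.withDensity D₀) (hκ : IsRegularCondProb P Z κ)
    {A : Set Ω} (hA : MeasurableSet[MeasurableSpace.comap p inferInstance] A) :
    ∀ᵐ z ∂(P.map Z), κ z A = ∫⁻ ω in A, D ω z / D₀ z ∂P := by
  have hA' : MeasurableSet A := hp.comap_le _ hA
  have hκA : Measurable fun z => κ z A := Kernel.measurable_coe κ hA'
  have hDA : Measurable fun z => ∫⁻ ω in A, D ω z ∂P := hD.lintegral_prod_left'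
  have h1 : (fun z => D₀ z * κ z A) =ᵐ[ν] fun z => ∫⁻ ω in A, D ω z ∂P := by
    -- Integrated over `B`, both sides give `P (Z ⁻¹' B ∩ A)`: one by disintegrating along `Z`, the
    -- other by Tonelli and the conditional law given `p`.
    refine ae_eq_of_forall_setLIntegral_eq_of_sigmaFinite (hD₀.mul hκA) hDA fun B hB _ => ?_
    have h2 : ∫⁻ z in B, D₀ z * κ z A ∂ν = P (Z ⁻¹' B ∩ A) := by
      rw [hκ.2 A B hA' hB, hD₀Z, setLIntegral_withDensity_eq_setLIntegral_mul _ hD₀ hκA hB]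
      rfl
    rw [h2, Set.inter_comm]
    have h3 : ∫⁻ z in B, ∫⁻ ω in A, D ω z ∂P ∂ν = ∫⁻ ω in A, ∫⁻ z in B, D ω z ∂ν ∂P :=
      (lintegral_lintegral_swap hD.aemeasurable).symm
    obtain ⟨C, hC, rfl⟩ := hA
    rw [h3, ← setLIntegral_preimage_condDistrib hp hZ.aemeasurable hB hC]
    refine lintegral_congr_ae (ae_restrict_of_ae ?_)
    filter_upwards [hDp] with ω hω
    rw [hω, withDensity_apply _ hB]
  have h2 : ∀ᵐ z ∂(P.map Z), D₀ z * κ z A = ∫⁻ ω in A, D ω z ∂P := by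
    rw [hD₀Z]
    exact (withDensity_absolutelyContinuous ν D₀).ae_le h1
  filter_upwards [h2, ae_ne_zero_and_ne_top_of_map_eq hZ hD₀ hD₀Z] with z hz hz0
  simp_rw [div_eq_mul_inv]
  rw [lintegral_mul_const _ (by exact hD.comp measurable_prodMk_right), ← hz, mul_comm (D₀ z), mul_assoc,
    ENNReal.mul_inv_cancel hz0.1 hz0.2, mul_one]

/-- Bayes' formula, simultaneously for all events of a σ-algebra that coincides, outside a null
set, with a countably generated one. -/
lemma ae_forall_condProb_eq_setLIntegral [StandardBorelSpace E] [Nonempty E]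
    (hp : Measurable p) (hZ : Measurable Z)
    (hD : Measurable (Function.uncurry D))
    (hDp : ∀ᵐ ω ∂P, condDistrib Z p P (p ω) = ν.withDensity (D ω))
    (hD₀ : Measurable D₀) (hD₀Z : P.map Z = ν.withDensity D₀) (hκ : IsRegularCondProb P Z κ)
    (hm' : m' ≤ MeasurableSpace.comap p inferInstance)
    (hcg : @MeasurableSpace.CountablyGenerated Ω m')
    {N : Set Ω} (hN : MeasurableSet N) (hPN : P N = 0)
    (hN' : ∀ A, MeasurableSet[MeasurableSpace.comap p inferInstance] A →
      ∃ A', MeasurableSet[m'] A' ∧ A \ N = A' \ N) :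
    ∀ᵐ z ∂(P.map Z), ∀ A, MeasurableSet[MeasurableSpace.comap p inferInstance] A →
      κ z A = ∫⁻ ω in A, D ω z / D₀ z ∂P := by
  have hle : m' ≤ mΩ := hm'.trans hp.comap_le
  have := hκ.1
  obtain ⟨b, hb, hbm⟩ := hcg.isCountablyGenerated
  -- A countable algebra generating `m'` is a π-system, so countably many exceptional null sets
  -- suffice to determine `κ z` on `m'`.
  set 𝒞 := generateSetAlgebra b with h𝒞
  have h𝒞c : 𝒞.Countable := countable_generateSetAlgebra hb
  have h𝒞m : m' = MeasurableSpace.generateFrom 𝒞 := by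
    rw [hbm, h𝒞, generateFrom_generateSetAlgebra_eq]
  have h𝒞A : IsSetAlgebra 𝒞 := isSetAlgebra_generateSetAlgebra
  have h1 : ∀ᵐ z ∂(P.map Z), ∀ A ∈ 𝒞, κ z A = ∫⁻ ω in A, D ω z / D₀ z ∂P := by
    rw [ae_ball_iff h𝒞c]
    intro A hA
    refine ae_condProb_eq_setLIntegral hp hZ hD hDp hD₀ hD₀Z hκ (hm' _ ?_)
    rw [h𝒞m]
    exact MeasurableSpace.measurableSet_generateFrom hA
  -- `N` is also null for almost every `κ z`, since these masses average to `P N = 0`; this permits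
  -- replacing `A` by `A'` under both measures.
  have h2 : ∀ᵐ z ∂(P.map Z), κ z N = 0 := by
    have h3 := hκ.2 N Set.univ hN MeasurableSet.univ
    rw [Set.preimage_univ, Set.univ_inter, hPN, setLIntegral_univ] at h3
    exact (lintegral_eq_zero_iff (Kernel.measurable_coe κ hN)).1 h3.symm
  filter_upwards [h1, h2] with z h1 h2
  set f : Ω → ℝ≥0∞ := fun ω => D ω z / D₀ z with hf
  have hfm : Measurable f := (hD.comp measurable_prodMk_right).div_const _
  have h3 : (κ z).trim hle = (P.withDensity f).trim hle := by
    refine @ext_of_generate_finite Ω m' _ _ 𝒞 h𝒞m ?_ (isFiniteMeasure_trim hle) ?_ ?_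
    · exact fun s hs t ht _ => h𝒞A.inter_mem hs ht
    · intro A hA
      have hA' : MeasurableSet[m'] A := by
        rw [h𝒞m]; exact MeasurableSpace.measurableSet_generateFrom hA
      rw [trim_measurableSet_eq hle hA', trim_measurableSet_eq hle hA', h1 A hA,
        withDensity_apply _ (hle _ hA')]
    · rw [trim_measurableSet_eq hle MeasurableSet.univ, trim_measurableSet_eq hle MeasurableSet.univ,
        h1 _ h𝒞A.univ_mem, withDensity_apply _ MeasurableSet.univ]
  intro A hA
  obtain ⟨A', hA', hAA'⟩ := hN' A hA
  have h4 : ∀ μ : Measure Ω, μ N = 0 → μ A = μ A' := fun μ hμ => by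
    rw [← measure_sdiff_null hμ, hAA', measure_sdiff_null hμ]
  rw [← withDensity_apply _ (hp.comap_le _ hA), h4 _ h2,
    h4 _ (withDensity_absolutelyContinuous P f hPN), ← trim_measurableSet_eq hle hA', h3,
    trim_measurableSet_eq hle hA']

/-- Positivity is assumed through the measures, so that it applies to every version of the density;
Fubini for null sets exchanges the two quantifiers. -/
lemma ae_ae_ne_zero (hD : Measurable (Function.uncurry D))
    (hD₀Z : P.map Z = ν.withDensity D₀) (hpos : ∀ᵐ ω ∂P, ν ≪ ν.withDensity (D ω)) :
    ∀ᵐ z ∂(P.map Z), ∀ᵐ ω ∂P, D ω z ≠ 0 := by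
  have hDω : ∀ ω, Measurable (D ω) := fun ω => hD.comp measurable_prodMk_left
  have h1 : ∀ᵐ ω ∂P, ∀ᵐ z ∂ν, D ω z ≠ 0 := by
    filter_upwards [hpos] with ω hω
    exact hω.ae_le ((ae_withDensity_iff (hDω ω)).2 (Eventually.of_forall fun z hz => hz))
  have hs : MeasurableSet {q : Ω × E | D q.1 q.2 ≠ 0} :=
    (hD (measurableSet_singleton 0)).compl
  have h2 : ∀ᵐ z ∂ν, ∀ᵐ ω ∂P, D ω z ≠ 0 := (Measure.ae_ae_comm hs).1 h1
  rw [hD₀Z]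
  exact (withDensity_absolutelyContinuous ν D₀).ae_le h2

end Bayes

/-! ### Path σ-algebras, covariance decomposition and joint measurability. -/

/-- The σ-algebra generated by a process with almost surely continuous paths coincides, outside
a null set, with a countably generated one. -/
lemma exists_countablyGenerated_comap {Ω τ : Type*} {mΩ : MeasurableSpace Ω} {P : Measure Ω}
    [TopologicalSpace τ] [SecondCountableTopology τ] [Nonempty τ]
    {Y : τ → Ω → ℝ} (hc : ∀ᵐ ω ∂P, Continuous fun t => Y t ω) :
    ∃ N : Set Ω, MeasurableSet N ∧ P N = 0 ∧ ∃ m' : MeasurableSpace Ω,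
      m' ≤ MeasurableSpace.comap (fun ω t => Y t ω) inferInstance ∧
      @MeasurableSpace.CountablyGenerated Ω m' ∧
        ∀ A, MeasurableSet[MeasurableSpace.comap (fun ω t => Y t ω) inferInstance] A →
          ∃ A', MeasurableSet[m'] A' ∧ A \ N = A' \ N := by
  set q : ℕ → τ := TopologicalSpace.denseSeq τ with hq
  set Q : Ω → ℕ → ℝ := fun ω n => Y (q n) ω with hQ
  have hseq : ∀ t, ∃ n : ℕ → ℕ, Tendsto (fun k => q (n k)) atTop (𝓝 t) := by
    intro t
    obtain ⟨x, hx, hxt⟩ := mem_closure_iff_seq_limit.1 (TopologicalSpace.denseRange_denseSeq τ t)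
    choose n hn using hx
    exact ⟨n, by simpa only [hq, hn] using hxt⟩
  choose n hn using hseq
  -- `Φ` rebuilds a path from its values on a dense sequence. It is measurable everywhere, whatever
  -- `limUnder` returns without a limit, and is correct on continuous paths.
  set Φ : (ℕ → ℝ) → τ → ℝ := fun y t => limUnder atTop fun k => y (n t k) with hΦ
  have hΦm : Measurable Φ := measurable_pi_lambda _ fun t =>
    (StronglyMeasurable.limUnder fun k => (measurable_pi_apply (n t k)).stronglyMeasurable).measurable
  obtain ⟨N, hNsub, hNm, hN0⟩ := exists_measurable_superset_of_null (ae_iff.1 hc)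
  refine ⟨N, hNm, hN0, MeasurableSpace.comap Q inferInstance, ?_,
    MeasurableSpace.CountablyGenerated.comap Q, ?_⟩
  · rintro _ ⟨C, hC, rfl⟩
    refine ⟨(fun (y : τ → ℝ) k => y (q k)) ⁻¹' C, ?_, rfl⟩
    exact hC.preimage (measurable_pi_lambda _ fun k => measurable_pi_apply _)
  · rintro _ ⟨C, hC, rfl⟩
    refine ⟨Q ⁻¹' (Φ ⁻¹' C), ⟨_, hΦm hC, rfl⟩, ?_⟩
    ext ω
    simp only [Set.mem_sdiff, Set.mem_preimage, and_congr_left_iff]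
    intro hω
    have hcont : Continuous fun t => Y t ω := by
      by_contra h
      exact hω (hNsub h)
    have : Φ (Q ω) = fun t => Y t ω := by
      ext t
      exact ((hcont.tendsto t).comp (hn t)).limUnder_eq
    rw [this]

lemma IsContinuousSemimartingale.ae_continuous {Ω : Type*} [mΩ : MeasurableSpace Ω] {T : ℝ≥0}
    {X : Set.Iic T → Ω → ℝ} {𝓖 : Filtration (Set.Iic T) mΩ} {P : Measure Ω}
    (h : IsContinuousSemimartingale X 𝓖 P) : ∀ᵐ ω ∂P, Continuous fun t => X t ω := by
  obtain ⟨-, M, V, ⟨-, -, hM⟩, ⟨-, hV⟩, hX⟩ := h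
  filter_upwards [hM, hV, hX] with ω hM hV hX
  simp_rw [hX]
  exact hM.add hV.2.1

lemma measurable_uncurry_gaussianDensity {Ω ι : Type*} [Fintype ι] [DecidableEq ι]
    {m : MeasurableSpace Ω} {μ : Ω → ι → ℝ} {Q : Ω → Matrix ι ι ℝ}
    (hμ : ∀ i, Measurable fun ω => μ ω i) (hQ : ∀ i j, Measurable fun ω => Q ω i j) :
    Measurable (Function.uncurry fun ω z => gaussianDensity (μ ω) (Q ω) z) :=
  measurable_gaussianDensity (fun i => (hμ i).comp measurable_fst)
    (fun i j => (hQ i j).comp measurable_fst)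
    (fun i => (measurable_pi_apply i).comp measurable_snd)

/-- Pythagoras in polarized form: it splits the covariance of `Z` into those of the residual and of
the regression. -/
lemma integral_mul_eq_of_orthogonal {Ω : Type*} {mΩ : MeasurableSpace Ω} {P : Measure Ω}
    {Y Y' V V' : Ω → ℝ} (hY : MemLp Y 2 P) (hY' : MemLp Y' 2 P)
    (hV : MemLp V 2 P) (hV' : MemLp V' 2 P) (h : ∫ ω, (Y ω - V ω) * V' ω ∂P = 0)
    (h' : ∫ ω, (Y' ω - V' ω) * V ω ∂P = 0) :
    ∫ ω, Y ω * Y' ω ∂P = ∫ ω, (Y ω - V ω) * (Y' ω - V' ω) ∂P + ∫ ω, V ω * V' ω ∂P := by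
  have h1 : Integrable (fun ω => (Y ω - V ω) * (Y' ω - V' ω)) P :=
    (hY.sub hV).integrable_mul (hY'.sub hV')
  have h2 : Integrable (fun ω => V ω * V' ω) P := hV.integrable_mul hV'
  have h3 : Integrable (fun ω => (Y ω - V ω) * V' ω) P := (hY.sub hV).integrable_mul hV'
  have h4 : Integrable (fun ω => (Y' ω - V' ω) * V ω) P := (hY'.sub hV').integrable_mul hV
  calc ∫ ω, Y ω * Y' ω ∂P = ∫ ω, (((Y ω - V ω) * (Y' ω - V' ω) + V ω * V' ω) +
      ((Y ω - V ω) * V' ω + (Y' ω - V' ω) * V ω)) ∂P := by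
        refine integral_congr_ae (Eventually.of_forall fun ω => ?_)
        ring
    _ = _ := by
      rw [integral_add (by exact h1.add h2) (by exact h3.add h4), integral_add h1 h2,
        integral_add h3 h4, h, h', add_zero, add_zero]

/-! ### Existence of the Gaussian densities and the change of measure. -/

section Densities

variable {Ω : Type*} {m mΩ : MeasurableSpace Ω} {P : Measure Ω} [IsProbabilityMeasure P] {T : ℝ≥0}
  {X : Set.Iic T → Ω → ℝ} {H : Submodule ℝ (Lp ℝ 2 P)} {ι : Type*} [Fintype ι]
  {Z : ι → Ω → ℝ}

lemma IsGaussianSpace.isCondDensity_and_isLawDensity [DecidableEq ι] (hH : IsGaussianSpace H)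
    (hXm : ∀ t, Measurable (X t)) (hX : ∀ t, RepresentsMem H (X t)) (hZm : ∀ i, Measurable (Z i))
    (hZ : ∀ i, RepresentsMem H (Z i)) (s : Set.Iic T)
    (hQ : ∀ᵐ ω ∂P,
      IsUnit (condCovMatrix Z P (MeasurableSpace.comap (path X s) inferInstance) ω)) :
    IsCondDensity X P (fun ω i => Z i ω) s
      (fun ω => gaussianDensity
        (fun i => (P[Z i | MeasurableSpace.comap (path X s) inferInstance]) ω)
        (condCovMatrix Z P (MeasurableSpace.comap (path X s) inferInstance) ω)) ∧
    IsLawDensity P (fun ω i => Z i ω)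
      (gaussianDensity 0 (Matrix.of fun i j => ∫ ω, Z i ω * Z j ω ∂P)) ∧
    ∀ᵐ ω ∂P, (volume : Measure (ι → ℝ)) ≪
      condDistrib (fun ω i => Z i ω) (path X s) P (path X s ω) := by
  have hp : Measurable (path X s) := measurable_pi_lambda _ fun u => hXm u
  have hZ' : Measurable fun ω i => Z i ω := measurable_pi_lambda _ hZm
  obtain ⟨W, hWm, hW, horth, hind⟩ := hH.exists_regression (X := fun (u : Set.Iic s) => X u)
    (fun u => hXm u) (fun u => hX u) hZ
  change ∀ i, RepresentsMem H fun ω => W i (path X s ω) at hW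
  change ∀ i j, ∫ ω, (Z i ω - W i (path X s ω)) * W j (path X s ω) ∂P = 0 at horth
  change IndepFun (fun ω i => Z i ω - W i (path X s ω)) (path X s) P at hind
  have hR : ∀ i, RepresentsMem H fun ω => Z i ω - W i (path X s ω) := fun i => (hZ i).sub (hW i)
  have hRm : ∀ i, Measurable fun ω => Z i ω - W i (path X s ω) :=
    fun i => (hZm i).sub ((hWm i).comp hp)
  have hZi : ∀ i, Integrable (Z i) P := fun i => (hZ i).1.integrable one_le_two
  have hWi : ∀ i, Integrable (fun ω => W i (path X s ω)) P := fun i => (hW i).1.integrable one_le_two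
  have h0 : ∀ i, ∫ ω, (Z i ω - W i (path X s ω)) ∂P = 0 :=
    fun i => hH.integral_eq_zero_of_representsMem (hR i)
  have hmean := condExp_of_regression hp hWm hZm hZi hWi h0 hind
  have hcov := condCovMatrix_of_regression hp hWm hZm hZi hWi h0 hind
  have hlaw := condDistrib_of_regression (Z := fun ω i => Z i ω) (W := fun x i => W i x) hp
    (measurable_pi_lambda _ hWm) hZ' hind
  set Q : Matrix ι ι ℝ :=
    Matrix.of fun i j => ∫ ω, (Z i ω - W i (path X s ω)) * (Z j ω - W j (path X s ω)) ∂P with hQdef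
  -- Since `Q` is deterministic, a single `ω` at which the conditional covariance equals `Q` and is
  -- invertible is enough.
  have hQpos : Q.PosDef := by
    obtain ⟨ω, h1, h2⟩ := (hQ.and hcov).exists
    rw [h2] at h1
    exact (posSemidef_momentMatrix fun i => (hR i).1).posDef_iff_isUnit.2 h1
  have hcond : ∀ᵐ ω ∂P, condDistrib (fun ω i => Z i ω) (path X s) P (path X s ω) =
      volume.withDensity (gaussianDensity (fun i => W i (path X s ω)) Q) := by
    filter_upwards [hlaw] with ω hω
    rw [hω, ← map_add_withDensity_gaussianDensity, ← hH.map_eq_withDensity hRm hR hQpos]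
    rfl
  refine ⟨⟨?_, ?_⟩, ⟨?_, ?_⟩, ?_⟩
  · refine measurable_uncurry_gaussianDensity (m := MeasurableSpace.comap (path X s) inferInstance)
      (fun i => stronglyMeasurable_condExp.measurable) fun i j => ?_
    exact stronglyMeasurable_condExp.measurable
  · filter_upwards [hcond, ae_all_iff.2 hmean, hcov] with ω h1 h2 h3
    simp only [h1, h2, h3]
  · exact measurable_gaussianDensity_right _ _
  · refine hH.map_eq_withDensity hZm hZ ?_
    have h1 : (Matrix.of fun i j => ∫ ω, Z i ω * Z j ω ∂P) =
        Q + Matrix.of fun i j => ∫ ω, W i (path X s ω) * W j (path X s ω) ∂P := by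
      ext i j
      exact integral_mul_eq_of_orthogonal (hZ i).1 (hZ j).1 (hW i).1 (hW j).1 (horth i j) (horth j i)
    rw [h1]
    exact hQpos.add_posSemidef (posSemidef_momentMatrix fun i => (hW i).1)
  · filter_upwards [hcond] with ω hω
    rw [hω]
    refine withDensity_absolutelyContinuous'
      (measurable_gaussianDensity_right _ _).aemeasurable ?_
    exact Eventually.of_forall fun z => (gaussianDensity_pos hQpos _ z).ne'

lemma ae_condProb_trim_eq_withDensity (hXm : ∀ t, Measurable (X t))
    (hXc : ∀ᵐ ω ∂P, Continuous fun t => X t ω) (hZm : ∀ i, Measurable (Z i)) (s : Set.Iic T)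
    (hac : ∀ᵐ ω ∂P, (volume : Measure (ι → ℝ)) ≪
      condDistrib (fun ω i => Z i ω) (path X s) P (path X s ω))
    {D : Ω → (ι → ℝ) → ℝ≥0∞} {D₀ : (ι → ℝ) → ℝ≥0∞} {κ : Kernel (ι → ℝ) Ω}
    (hD : IsCondDensity X P (fun ω i => Z i ω) s D) (hD₀ : IsLawDensity P (fun ω i => Z i ω) D₀)
    (hκ : IsRegularCondProb P (fun ω i => Z i ω) κ)
    (hm : m = MeasurableSpace.comap (path X s) inferInstance)
    (hle : m ≤ mΩ) :
    ∀ᵐ z ∂(P.map fun ω i => Z i ω),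
      (κ z).trim hle ≪ P.trim hle ∧ P.trim hle ≪ (κ z).trim hle ∧
      (κ z).trim hle = (P.trim hle).withDensity fun ω => D ω z / D₀ z := by
  subst hm
  have hp : Measurable (path X s) := measurable_pi_lambda _ fun u => hXm u
  have hZ' : Measurable fun ω i => Z i ω := measurable_pi_lambda _ hZm
  have : Nonempty (Set.Iic s) := ⟨⟨s, Set.self_mem_Iic⟩⟩
  have hYc : ∀ᵐ ω ∂P, Continuous fun u : Set.Iic s => X u ω := by
    filter_upwards [hXc] with ω hω using hω.comp continuous_subtype_val
  have hDm : Measurable (Function.uncurry D) :=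
    hD.1.mono (sup_le_sup_right (MeasurableSpace.comap_mono hle) _) le_rfl
  have hbayes : ∀ᵐ z ∂(P.map fun ω i => Z i ω), ∀ A,
      MeasurableSet[MeasurableSpace.comap (path X s) inferInstance] A →
        κ z A = ∫⁻ ω in A, D ω z / D₀ z ∂P := by
    obtain ⟨N, hN, hPN, m', hm', hcg, hN'⟩ := exists_countablyGenerated_comap hYc
    exact ae_forall_condProb_eq_setLIntegral hp hZ' hDm hD.2 hD₀.1 hD₀.2 hκ hm' hcg hN hPN hN'
  -- The conditional law has a positive Gaussian density, so Lebesgue measure is absolutely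
  -- continuous with respect to it, whichever version `D` is given.
  have hpos := ae_ae_ne_zero (ν := volume) hDm hD₀.2 (by
    filter_upwards [hac, hD.2] with ω h1 h2
    rwa [← h2])
  filter_upwards [hbayes, hpos, ae_ne_zero_and_ne_top_of_map_eq hZ' hD₀.1 hD₀.2] with z h1 h2 h3
  have hfm : Measurable[MeasurableSpace.comap (path X s) inferInstance]
      fun ω => D ω z / D₀ z :=
    (hD.1.comp (@measurable_prodMk_right _ _ (MeasurableSpace.comap (path X s) inferInstance) _ z)
      ).div_const _
  have heq := trim_eq_withDensity hle hfm h1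
  refine ⟨?_, ?_, heq⟩
  · rw [heq]
    exact withDensity_absolutelyContinuous _ _
  · rw [heq]
    refine withDensity_absolutelyContinuous' hfm.aemeasurable (ae_trim_of_ae_ne_zero hle hfm ?_)
    filter_upwards [h2] with ω hω
    exact (ENNReal.div_pos hω h3.2).ne'

end Densities

end GaussianBridge

end

theorem mainTheorem5 {Ω : Type*} [mΩ : MeasurableSpace Ω] (P : Measure Ω) [IsProbabilityMeasure P]
    (T : ℝ≥0) (X : Set.Iic T → Ω → ℝ)
    -- `X` is a continuous centered Gaussian semimartingale starting from `0`
    (hXm : ∀ t, StronglyMeasurable (X t))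
    (𝓖 : Filtration (Set.Iic T) mΩ) (hXsemi : GaussianBridge.IsContinuousSemimartingale X 𝓖 P)
    (hXgauss : IsGaussianProcess X P) (hXcent : ∀ t, ∫ ω, X t ω ∂P = 0)
    (hX0 : ∀ᵐ ω ∂P, X ⊥ ω = 0)
    -- `Z i = ∫₀ᵀ f i dX` with `f i` bounded and measurable
    {ι : Type*} [Fintype ι] [DecidableEq ι] (f : ι → Set.Iic T → ℝ)
    (hfm : ∀ i, Measurable (f i)) (hfb : ∀ i, ∃ C, ∀ t, |f i t| ≤ C)
    (Z : ι → Ω → ℝ) (hZm : ∀ i, Measurable (Z i))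
    (hZ : ∀ i, GaussianBridge.HasIntegral X P (f i) (Z i))
    -- the conditional covariance matrix of `Z` given the path up to `s` is invertible if `s < T`
    (hH : ∀ s : Set.Iic T, (s : ℝ≥0) < T →
      ∀ᵐ ω ∂P, IsUnit (GaussianBridge.condCovMatrix Z P (Filtration.natural X hXm s) ω))
    (s : Set.Iic T) (hs : (s : ℝ≥0) < T) :
    -- the Gaussian densities with the conditional (resp. plain) means and covariances of `Z` are
    -- densities of the conditional (resp. plain) distribution of `Z`
    GaussianBridge.IsCondDensity X P (fun ω i => Z i ω) s
      (fun ω => GaussianBridge.gaussianDensity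
        (fun i => (P[Z i | Filtration.natural X hXm s]) ω)
        (GaussianBridge.condCovMatrix Z P (Filtration.natural X hXm s) ω)) ∧
    GaussianBridge.IsLawDensity P (fun ω i => Z i ω)
      (GaussianBridge.gaussianDensity 0 (Matrix.of fun i j => ∫ ω, Z i ω * Z j ω ∂P)) ∧
    -- whatever the versions of the densities and of the conditional probability given `Z`
    ∀ (D : Ω → (ι → ℝ) → ℝ≥0∞) (D₀ : (ι → ℝ) → ℝ≥0∞) (κ : Kernel (ι → ℝ) Ω),
      GaussianBridge.IsCondDensity X P (fun ω i => Z i ω) s D →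
      GaussianBridge.IsLawDensity P (fun ω i => Z i ω) D₀ →
      GaussianBridge.IsRegularCondProb P (fun ω i => Z i ω) κ →
      ∀ᵐ z ∂(P.map fun ω i => Z i ω),
        (κ z).trim ((Filtration.natural X hXm).le s) ≪ P.trim ((Filtration.natural X hXm).le s) ∧
        P.trim ((Filtration.natural X hXm).le s) ≪ (κ z).trim ((Filtration.natural X hXm).le s) ∧
        (κ z).trim ((Filtration.natural X hXm).le s) =
          (P.trim ((Filtration.natural X hXm).le s)).withDensity fun ω => D ω z / D₀ z := by
  have hL2 : ∀ t, MemLp (X t) 2 P := fun t => (hXgauss.hasGaussianLaw_eval t).memLp_two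
  have hG := GaussianBridge.isGaussianSpace_gaussianSpace hXgauss hL2 hXcent
  have hXH := GaussianBridge.representsMem_gaussianSpace hL2
  have hm : Filtration.natural X hXm s =
      MeasurableSpace.comap (GaussianBridge.path X s) inferInstance :=
    Filtration.natural_eq_comap X hXm s
  obtain ⟨h1, h2, h3⟩ := hG.isCondDensity_and_isLawDensity (fun t => (hXm t).measurable) hXH hZm
    (fun i => (hZ i).representsMem hG hXH) s (by simpa only [← hm] using hH s hs)
  refine ⟨by simpa only [← hm] using h1, h2, fun D D₀ κ hD hD₀ hκ => ?_⟩
  exact GaussianBridge.ae_condProb_trim_eq_withDensity (fun t => (hXm t).measurable)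
    hXsemi.ae_continuous hZm s h3 hD hD₀ hκ hm _
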